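/- Let \(M\in \mathrm{SL}_3(\mathbb{Z})\) be a matrix with eigenvalues \(\alpha,\beta,\overline{\beta}\), where \(\alpha>1\) is real and \(\beta\neq\overline{\beta}\). Let \((a_1,a_2,a_3)^T\in\mathbb{R}^3\) be a real eigenvector of \(M\) for \(\alpha\), and \((b_1,b_2,b_3)^T\in\mathbb{C}^3\) an eigenvector of \(M\) for \(\beta\). Let \(\mathbb{H}\) be the upper half plane, and let \(G_M\) be the group of automorphisms of \(\mathbb{H}\times\mathbb{C}\) generated by \[ g_0(w,z)=(\alpha w,\beta z),\qquad g_i(w,z)=(w+a_i,z+b_i),\quad i=1,2,3 . \] An Inoue surface of type \(S_M\) is a complex surface isomorphic to the quotient complex manifold \((\mathbb{H}\times\mathbb{C})/G_M\) for some such data. A torsion group is a group all of whose elements have finite order. Theorem. Let \(X\) be an Inoue surface of type \(S_M\), and let \(\mathrm{Aut}(X)\) be its group of biholomorphic automorphisms. Then every torsion subgroup of \(\mathrm{Aut}(X)\) is finite. Moreover, \(\mathrm{Aut}(X)\) is T-Jordan: there is a constant \(J\), depending only on \(X\), such that every torsion subgroup \(H\leq\mathrm{Aut}(X)\) has an abelian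 subgroup \(H_1\) with \([H:H_1]\leq J\). -/

import Mathlib

open scoped UpperHalfPlane Manifold ContDiff ComplexConjugate

/-- A group `G` is *T-Jordan* if there is a constant `J` such that every torsion subgroup `H` of `G`
has an abelian subgroup `H₁` of index at most `J` in `H`. (Mathlib's `index` is `0` for subgroups
of infinite index, hence the condition `FiniteIndex`.) -/
def IsTJordan (G : Type*) [Group G] : Prop :=
  ∃ J : ℕ, ∀ H : Subgroup G, (∀ h ∈ H, IsOfFinOrder h) →
    ∃ H₁ : Subgroup H, (∀ x ∈ H₁, ∀ y ∈ H₁, x * y = y * x) ∧ H₁.FiniteIndex ∧ H₁.index ≤ J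

/-- The group `Aut(X)` of biholomorphic self-maps of a complex manifold `X` modelled on the complex
normed space `E`, under composition. Over `ℂ`, the class `C^ω` (analytic in charts) is the class of
holomorphic maps. -/
def holomorphicAut (E : Type*) [NormedAddCommGroup E] [NormedSpace ℂ E]
    (X : Type*) [TopologicalSpace X] [ChartedSpace E X] : Subgroup (Equiv.Perm X) where
  carrier := {f | ContMDiff 𝓘(ℂ, E) 𝓘(ℂ, E) ω f ∧ ContMDiff 𝓘(ℂ, E) 𝓘(ℂ, E) ω f.symm}
  mul_mem' := fun {_ _} hf hg => ⟨hf.1.comp hg.1, hg.2.comp hf.2⟩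
  one_mem' := ⟨contMDiff_id, contMDiff_id⟩
  inv_mem' := fun {_} hf => ⟨hf.2, hf.1⟩

/-- The data from which an Inoue surface of type `S_M` is constructed: a matrix `M ∈ SL₃(ℤ)` whose
eigenvalues are `α, β, conj β` with `α > 1` real and `β ≠ conj β`, a real eigenvector `a` for `α`
and a complex eigenvector `b` for `β`. -/
structure InoueSMData where
  M : Matrix.SpecialLinearGroup (Fin 3) ℤ
  α : ℝ
  β : ℂ
  a : Fin 3 → ℝ
  b : Fin 3 → ℂ
  one_lt_α : 1 < α
  β_ne_conj : β ≠ conj β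
  eigenvalues : ((M.1.map (Int.cast : ℤ → ℂ)).charpoly).roots = {(α : ℂ), β, conj β}
  a_ne_zero : a ≠ 0
  a_eigen : (M.1.map (Int.cast : ℤ → ℝ)).mulVec a = α • a
  b_ne_zero : b ≠ 0
  b_eigen : (M.1.map (Int.cast : ℤ → ℂ)).mulVec b = β • b

namespace InoueSMData

variable (D : InoueSMData)

theorem α_pos : 0 < D.α := zero_lt_one.trans D.one_lt_α

theorem β_ne_zero : D.β ≠ 0 := fun h => D.β_ne_conj (by simp [h])

/-- `g₀(w, z) = (α w, β z)` on `ℍ × ℂ`. -/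
noncomputable def g₀ : Equiv.Perm (ℍ × ℂ) :=
  Equiv.prodCongr (MulAction.toPerm (⟨D.α, D.α_pos⟩ : {x : ℝ // 0 < x}))
    (Equiv.mulLeft₀ D.β D.β_ne_zero)

/-- `gᵢ(w, z) = (w + aᵢ, z + bᵢ)` on `ℍ × ℂ`, for `i = 1, 2, 3`. -/
noncomputable def g (i : Fin 3) : Equiv.Perm (ℍ × ℂ) :=
  Equiv.prodCongr (AddAction.toPerm (D.a i)) (Equiv.addRight (D.b i))

theorem g₀_apply_fst (p : ℍ × ℂ) : ((D.g₀ p).1 : ℂ) = D.α * (p.1 : ℂ) := by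
  simp [g₀]

theorem g₀_apply_snd (p : ℍ × ℂ) : (D.g₀ p).2 = D.β * p.2 := rfl

theorem g_apply_fst (i : Fin 3) (p : ℍ × ℂ) : ((D.g i p).1 : ℂ) = (p.1 : ℂ) + D.a i := by
  simp [g, add_comm]

theorem g_apply_snd (i : Fin 3) (p : ℍ × ℂ) : (D.g i p).2 = p.2 + D.b i := rfl

/-- The group `G_M` of automorphisms of `ℍ × ℂ` generated by `g₀, g₁, g₂, g₃`. -/
def G : Subgroup (Equiv.Perm (ℍ × ℂ)) :=
  Subgroup.closure (insert D.g₀ (Set.range D.g))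

end InoueSMData

/-- The complex surface `X` is an Inoue surface of type `S_M`: for some data `D` as above, `X` is
the quotient complex manifold `(ℍ × ℂ) / G_M`. That is, there is a surjective locally biholomorphic
projection `π : ℍ × ℂ → X` whose fibres are exactly the orbits of `G_M`; this determines the complex
manifold `X` up to biholomorphism. -/
def IsInoueSurfaceSM (X : Type*) [TopologicalSpace X] [ChartedSpace (ℂ × ℂ) X] : Prop :=
  ∃ (D : InoueSMData) (π : ℍ × ℂ → X),
    IsLocalDiffeomorph (𝓘(ℂ).prod 𝓘(ℂ)) 𝓘(ℂ, ℂ × ℂ) ω π ∧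
    Function.Surjective π ∧
    ∀ p q : ℍ × ℂ, π p = π q ↔ ∃ g ∈ D.G, g p = q

/-! `Aut(X)` itself is finite, so both claims are immediate. The projection from the simply
connected `ℍ × ℂ` is a covering with deck group `G_M`, so an automorphism of `X` lifts to a
biholomorphism `F` normalising `G_M`.

Commutators in `G_M` are translations, and conjugation by `F` preserves commutators. Hence `dF` is
invariant under a rank 3 lattice of translations of `ℝ × ℂ`. Liouville's theorem in `z`, and density
of the lattice's projection to `ℝ` in `w`, make `dF` constant (`eq_of_invariant`). So `F` is affine,
and normalising `G_M` forces the shape `(p w + v₁, s z + v₂)` with `p > 0` and `v₁` real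
(`exists_isDiagAffine_of_normalizes`).

Modulo `G_M`, one may take `1 ≤ p ≤ α` and `v` bounded; integrality of determinants gives `p |s|² ≤
1`. Then `F` is determined by boundedly many lattice vectors of bounded size, which leaves finitely
many cases (`finite_reducedNormalizer`). -/

/-- The diagonal map `(x, z) ↦ (p x, s z)` on `ℝ × ℂ`. -/
noncomputable def diagScale (p : ℝ) (s : ℂ) : ℝ × ℂ →ₗ[ℝ] ℝ × ℂ :=
  (LinearMap.mulLeft ℝ p).prodMap (LinearMap.mulLeft ℝ s)

@[simp] theorem diagScale_apply (p : ℝ) (s : ℂ) (v : ℝ × ℂ) :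
    diagScale p s v = (p * v.1, s * v.2) := rfl

theorem det_diagScale (p : ℝ) (s : ℂ) : LinearMap.det (diagScale p s) = p * Complex.normSq s := by
  have h1 : LinearMap.det (LinearMap.mulLeft ℝ p) = p := by simp
  have h2 : LinearMap.det (LinearMap.mulLeft ℝ s) = Complex.normSq s := by
    rw [← Algebra.norm_complex_apply, Algebra.norm_apply]; rfl
  rw [diagScale, LinearMap.det_prodMap, h1, h2]

/-! ### The lattice of translations -/

namespace InoueSMData

variable (D : InoueSMData)

theorem α_ne_β : (D.α : ℂ) ≠ D.β := fun h => D.β_ne_conj (by simp [← h])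

theorem α_ne_conj_β : (D.α : ℂ) ≠ conj D.β := fun h =>
  D.α_ne_β (by simpa using congrArg conj h)

theorem β_ne_one : D.β ≠ 1 := fun h => D.β_ne_conj (by simp [h])

/-- The three generators `(aᵢ, bᵢ)` of the lattice of translations. -/
def period (i : Fin 3) : ℝ × ℂ := (D.a i, D.b i)

theorem eigenvectors_linearIndependent :
    LinearIndependent ℂ ![fun i => (D.a i : ℂ), D.b, fun i => conj (D.b i)] := by
  refine Module.End.eigenvectors_linearIndependent'
    (Matrix.toLin' (D.M.1.map (Int.cast : ℤ → ℂ))) ![(D.α : ℂ), D.β, conj D.β] ?_ _ ?_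
  · intro i j h
    have h1 := D.α_ne_β
    have h2 := D.α_ne_conj_β
    have h3 := D.β_ne_conj
    fin_cases i <;> fin_cases j <;> simp_all
  · intro i
    rw [Module.End.hasEigenvector_iff, Module.End.mem_eigenspace_iff, Matrix.toLin'_apply]
    fin_cases i
    · refine ⟨?_, fun h => D.a_ne_zero ?_⟩
      · funext j
        have := congrArg (Complex.ofReal) (congrFun D.a_eigen j)
        simpa [Matrix.mulVec, dotProduct] using this
      · funext j
        simpa using congrFun h j
    · exact ⟨D.b_eigen, D.b_ne_zero⟩
    · refine ⟨?_, fun h => D.b_ne_zero ?_⟩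
      · funext j
        have := congrArg conj (congrFun D.b_eigen j)
        simpa [Matrix.mulVec, dotProduct] using this
      · funext j
        simpa using congrFun h j

theorem linearIndependent_period : LinearIndependent ℝ D.period := by
  rw [Fintype.linearIndependent_iff]
  intro x hx
  have h1 : ∑ i, x i * D.a i = 0 := by
    simpa [period, Prod.fst_sum] using congrArg Prod.fst hx
  have h2 : ∑ i, (x i : ℂ) * D.b i = 0 := by
    simpa [period, Prod.snd_sum] using congrArg Prod.snd hx
  have hspan := D.eigenvectors_linearIndependent.span_eq_top_of_card_eq_finrank (by simp)
  -- As `x` is real, conjugating `h2` gives the relation for `conj b` too; a functional vanishing on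
  -- an eigenbasis is zero.
  have hzero : Fintype.linearCombination ℂ (fun i => (x i : ℂ)) = 0 := by
    refine LinearMap.ext_on_range hspan fun i => ?_
    rw [Fintype.linearCombination_apply]
    fin_cases i
    · simpa [mul_comm] using congrArg Complex.ofReal h1
    · simpa [mul_comm] using h2
    · simpa [mul_comm] using congrArg conj h2
  intro i
  simpa [Fintype.linearCombination_apply, Pi.single_apply] using
    LinearMap.congr_fun hzero (Pi.single i 1)

/-- The generators `(aᵢ, bᵢ)` form a real basis of `ℝ × ℂ`. -/
noncomputable def periodBasis : Module.Basis (Fin 3) ℝ (ℝ × ℂ) :=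
  basisOfLinearIndependentOfCardEqFinrank D.linearIndependent_period (by simp)

@[simp] theorem coe_periodBasis : ⇑D.periodBasis = D.period := by
  simp [periodBasis]

/-- The lattice in `ℝ × ℂ` spanned by the `(aᵢ, bᵢ)`. -/
def lattice : Submodule ℤ (ℝ × ℂ) := Submodule.span ℤ (Set.range D.period)

theorem period_mem_lattice (i : Fin 3) : D.period i ∈ D.lattice :=
  Submodule.subset_span ⟨i, rfl⟩

theorem diagScale_period (i : Fin 3) :
    diagScale D.α D.β (D.period i) = ∑ j, D.M.1 i j • D.period j := by
  have h1 := congrFun D.a_eigen i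
  have h2 := congrFun D.b_eigen i
  simp only [Matrix.mulVec, dotProduct, Matrix.map_apply, Pi.smul_apply, smul_eq_mul] at h1 h2
  ext1 <;> simp [period, Prod.fst_sum, Prod.snd_sum, h1, h2]

theorem diagScale_mem_lattice_of {p : ℝ} {s : ℂ}
    (h : ∀ i, diagScale p s (D.period i) ∈ D.lattice) {v : ℝ × ℂ} (hv : v ∈ D.lattice) :
    diagScale p s v ∈ D.lattice := by
  have : D.lattice ≤ D.lattice.comap ((diagScale p s).restrictScalars ℤ) :=
    Submodule.span_le.2 (by rintro _ ⟨i, rfl⟩; exact h i)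
  exact this hv

theorem diagScale_mem_lattice {v : ℝ × ℂ} (hv : v ∈ D.lattice) :
    diagScale D.α D.β v ∈ D.lattice :=
  D.diagScale_mem_lattice_of (fun i => D.diagScale_period i ▸
    Submodule.sum_mem _ fun j _ => Submodule.smul_mem _ _ (D.period_mem_lattice j)) hv

/-- `M⁻¹` again has integer entries because `det M = 1`. -/
theorem diagScale_inv_mem_lattice {v : ℝ × ℂ} (hv : v ∈ D.lattice) :
    diagScale D.α⁻¹ D.β⁻¹ v ∈ D.lattice := by
  refine D.diagScale_mem_lattice_of (fun i => ?_) hv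
  have key : diagScale D.α D.β (∑ j, (D.M⁻¹).1 i j • D.period j) = D.period i := by
    simp only [map_sum, map_zsmul, diagScale_period, Finset.smul_sum, smul_smul]
    rw [Finset.sum_comm]
    simp only [← Finset.sum_smul, ← Matrix.mul_apply]
    have : (D.M⁻¹).1 * D.M.1 = 1 := congrArg Subtype.val (inv_mul_cancel D.M)
    rw [this]
    simp [Matrix.one_apply]
  rw [← key]
  have : ∀ w, diagScale D.α⁻¹ D.β⁻¹ (diagScale D.α D.β w) = w := fun w => by
    have := D.α_pos.ne'
    have := D.β_ne_zero
    ext1 <;> simp [*]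
  rw [this]
  exact Submodule.sum_mem _ fun j _ => Submodule.smul_mem _ _ (D.period_mem_lattice j)

theorem diagScale_zpow_mem_lattice (n : ℤ) {v : ℝ × ℂ} (hv : v ∈ D.lattice) :
    diagScale (D.α ^ n) (D.β ^ n) v ∈ D.lattice := by
  have h1 := D.α_pos.ne'
  have h2 := D.β_ne_zero
  induction n with
  | zero => simpa using hv
  | succ n ih =>
    have := D.diagScale_mem_lattice ih
    simp only [diagScale_apply, ← mul_assoc] at this ⊢
    rwa [zpow_add_one₀ h1, zpow_add_one₀ h2, mul_comm _ D.α, mul_comm _ D.β]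
  | pred n ih =>
    have := D.diagScale_inv_mem_lattice ih
    simp only [diagScale_apply, ← mul_assoc] at this ⊢
    rwa [zpow_sub_one₀ h1, zpow_sub_one₀ h2, mul_comm _ D.α⁻¹, mul_comm _ D.β⁻¹]

/-- The first coordinates of the lattice are dense in `ℝ`. -/
theorem dense_fst_lattice : Dense (Prod.fst '' (D.lattice : Set (ℝ × ℂ))) := by
  let S : AddSubgroup ℝ := D.lattice.toAddSubgroup.map (AddMonoidHom.fst ℝ ℂ)
  have hS : (S : Set ℝ) = Prod.fst '' (D.lattice : Set (ℝ × ℂ)) := rfl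
  rw [← hS]
  refine S.dense_of_not_isolated_zero fun ε hε => ?_
  obtain ⟨i, hi⟩ := Function.ne_iff.1 D.a_ne_zero
  obtain ⟨n, hn⟩ := exists_pow_lt_of_lt_one (div_pos hε (abs_pos.2 hi))
    (inv_lt_one_of_one_lt₀ D.one_lt_α)
  -- Since the lattice is stable under inverse scaling, contracting one nonzero `aᵢ` yields
  -- arbitrarily small nonzero elements.
  have hmem : (D.α⁻¹) ^ n * D.a i ∈ S := by
    refine ⟨_, D.diagScale_zpow_mem_lattice (-n) (D.period_mem_lattice i), ?_⟩
    simp [period]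
  have hpos := pow_pos (inv_pos.2 D.α_pos) n
  refine ⟨|D.α⁻¹ ^ n * D.a i|, ?_, abs_pos.2 (mul_ne_zero hpos.ne' hi), ?_⟩
  · rcases abs_choice (D.α⁻¹ ^ n * D.a i) with h | h <;> rw [h]
    exacts [hmem, S.neg_mem hmem]
  · rw [abs_mul, abs_of_pos hpos]
    exact (lt_div_iff₀ (abs_pos.2 hi)).1 hn

/-- Every point of `ℝ × ℂ` is within bounded distance of the lattice. -/
theorem exists_mem_lattice_norm_sub_le (v : ℝ × ℂ) :
    ∃ u ∈ D.lattice, ‖v - u‖ ≤ ∑ i, ‖D.period i‖ := by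
  refine ⟨ZSpan.floor D.periodBasis v, ?_, ?_⟩
  · have := (ZSpan.floor D.periodBasis v).2
    simpa [lattice] using this
  · have := ZSpan.norm_fract_le (K := ℝ) D.periodBasis v
    simpa [ZSpan.fract] using this

theorem finite_lattice_inter_closedBall (R : ℝ) :
    (Metric.closedBall 0 R ∩ (D.lattice : Set (ℝ × ℂ))).Finite := by
  have := ZSpan.setFinite_inter D.periodBasis
    (Metric.isBounded_closedBall (x := (0 : ℝ × ℂ)) (r := R))
  simpa [lattice] using this

/-- A nonsingular diagonal map preserving the lattice has determinant at least one. -/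
theorem one_le_mul_normSq {p : ℝ} {s : ℂ} (hp : 0 < p) (hs : s ≠ 0)
    (h : ∀ i, diagScale p s (D.period i) ∈ D.lattice) : 1 ≤ p * Complex.normSq s := by
  have h' : ∀ i, ∃ k : Fin 3 → ℤ, ∑ j, k j • D.period j = diagScale p s (D.period i) := fun i =>
    (Submodule.mem_span_range_iff_exists_fun ℤ).1 (h i)
  choose N hN using h'
  have hmat : LinearMap.toMatrix D.periodBasis D.periodBasis (diagScale p s) =
      (Matrix.of fun j i => N i j).map (Int.cast : ℤ → ℝ) := by
    ext j i
    rw [LinearMap.toMatrix_apply, coe_periodBasis, ← hN, ← coe_periodBasis]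
    simp only [map_sum, map_zsmul, Module.Basis.repr_self, Finsupp.coe_finsetSum,
      Finset.sum_apply, Finsupp.smul_apply, Finsupp.single_apply]
    simp
  -- In the period basis the map is an integer matrix, so its positive determinant is a positive
  -- integer.
  have hdet : p * Complex.normSq s = ((Matrix.of fun j i => N i j).det : ℤ) := by
    rw [← det_diagScale, ← LinearMap.det_toMatrix D.periodBasis, hmat]
    exact (Int.cast_det _).symm
  have hpos : 0 < p * Complex.normSq s := mul_pos hp (Complex.normSq_pos.2 hs)
  rw [hdet] at hpos ⊢
  exact_mod_cast hpos

end InoueSMData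

/-! ### Holomorphic functions invariant under translations -/

/-- The product of the open upper half plane and the complex plane, as a subset of `ℂ × ℂ`. -/
def upperProd : Set (ℂ × ℂ) := {x | 0 < x.1.im}

theorem isOpen_upperProd : IsOpen upperProd :=
  isOpen_lt continuous_const (Complex.continuous_im.comp continuous_fst)

theorem convex_upperProd : Convex ℝ upperProd :=
  (convex_halfSpace_im_gt 0).linear_preimage (LinearMap.fst ℝ ℂ ℂ)

/-- The translation vector of `ℂ × ℂ` given by a vector of `ℝ × ℂ`. -/
def toComplexProd (v : ℝ × ℂ) : ℂ × ℂ := (v.1, v.2)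

section Invariant

variable {V : Type*} [NormedAddCommGroup V] [NormedSpace ℂ V] {h : ℂ × ℂ → V} {Λ : Set (ℝ × ℂ)}

/-- A holomorphic function on `ℍ × ℂ` invariant under a cocompact set of translations of `ℝ × ℂ`
does not depend on the second variable. -/
theorem eq_of_fst_eq_of_invariant (hd : DifferentiableOn ℂ h upperProd)
    (hinv : ∀ x ∈ upperProd, ∀ v ∈ Λ, h (x + toComplexProd v) = h x)
    {R : ℝ} (hR : ∀ v : ℝ × ℂ, ∃ u ∈ Λ, ‖v - u‖ ≤ R) {w : ℂ} (hw : 0 < w.im) (z z' : ℂ) :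
    h (w, z) = h (w, z') := by
  have hdz : Differentiable ℂ fun z => h (w, z) := fun z =>
    (hd.differentiableAt (isOpen_upperProd.mem_nhds (by exact hw : (w, z) ∈ upperProd))).comp z
      ((differentiableAt_const w).prodMk differentiableAt_id)
  -- Liouville: translation by the lattice keeps `im w` fixed and brings `(w, z)` into the compact
  -- set `K`.
  refine hdz.apply_eq_apply_of_bounded ?_ z z'
  let K : Set (ℂ × ℂ) := (fun v : ℝ × ℂ => (v.1 + w.im * Complex.I, v.2)) '' Metric.closedBall 0 R
  have hK : IsCompact K := (isCompact_closedBall _ _).image (by fun_prop)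
  have hKU : K ⊆ upperProd := by
    rintro _ ⟨v, -, rfl⟩
    simpa [upperProd] using hw
  refine (hK.image_of_continuousOn (hd.continuousOn.mono hKU)).isBounded.subset ?_
  rintro _ ⟨z, rfl⟩
  obtain ⟨u, hu, huR⟩ := hR (w.re, z)
  have hmem : (((w.re - u.1 : ℝ) : ℂ) + w.im * Complex.I, z - u.2) ∈ K :=
    ⟨(w.re, z) - u, by simpa using huR, rfl⟩
  refine ⟨_, hmem, ?_⟩
  rw [← hinv _ (hKU hmem) u hu]
  congr 1
  ext1
  · simp only [toComplexProd, Prod.fst_add]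
    conv_rhs => rw [← Complex.re_add_im w]
    push_cast
    ring
  · simp [toComplexProd]

/-- A holomorphic function on `ℍ × ℂ` invariant under a set of translations of `ℝ × ℂ` that is
cocompact and has dense projection to `ℝ` is constant. -/
theorem eq_of_invariant (hd : DifferentiableOn ℂ h upperProd)
    (hinv : ∀ x ∈ upperProd, ∀ v ∈ Λ, h (x + toComplexProd v) = h x)
    {R : ℝ} (hR : ∀ v : ℝ × ℂ, ∃ u ∈ Λ, ‖v - u‖ ≤ R) (hdense : Dense (Prod.fst '' Λ))
    {x y : ℂ × ℂ} (hx : x ∈ upperProd) (hy : y ∈ upperProd) : h x = h y := by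
  let U : Set ℂ := {w | 0 < w.im}
  have hU : IsOpen U := isOpen_lt continuous_const Complex.continuous_im
  have hfst := fun {w : ℂ} (hw : 0 < w.im) => eq_of_fst_eq_of_invariant hd hinv hR hw
  let k : ℂ → V := fun w => h (w, 0)
  have hk : DifferentiableOn ℂ k U := fun w hw =>
    ((hd.differentiableAt (isOpen_upperProd.mem_nhds (by exact hw : (w, (0 : ℂ)) ∈ upperProd))).comp
      w (differentiableAt_id.prodMk (differentiableAt_const 0))).differentiableWithinAt
  have hreal : ∀ w ∈ U, ∀ t : ℝ, k (w + t) = k w := by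
    intro w hw
    have hmem : ∀ t : ℝ, w + t ∈ U := fun t => by simpa [U] using hw
    have hc : Continuous fun t : ℝ => k (w + t) :=
      hk.continuousOn.comp_continuous (by fun_prop) hmem
    refine fun t => congrFun (hc.ext_on hdense continuous_const ?_) t
    rintro _ ⟨v, hv, rfl⟩
    have h1 := hinv (w, 0) hw v hv
    exact (hfst (hmem v.1) (0 : ℂ) (0 + v.2)).trans h1
  -- The complex derivative can be computed along the real direction, where `k` is constant.
  have hderiv : ∀ w ∈ U, deriv k w = 0 := by
    intro w hw
    have h1 : HasDerivAt k (deriv k w) (w + ((0 : ℝ) : ℂ)) := by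
      simpa using (hk.differentiableAt (hU.mem_nhds hw)).hasDerivAt
    have h2 : HasDerivAt (fun t : ℝ => w + (t : ℂ)) 1 0 :=
      (Complex.ofRealCLM.hasDerivAt (x := (0 : ℝ))).const_add w
    have h3 := h1.scomp_of_eq (0 : ℝ) h2 rfl
    have h4 : HasDerivAt (k ∘ fun t : ℝ => w + (t : ℂ)) 0 0 := by
      have : (k ∘ fun t : ℝ => w + (t : ℂ)) = fun _ => k w := funext (hreal w hw)
      rw [this]
      exact hasDerivAt_const _ _
    simpa using h3.unique h4
  have hconst : k x.1 = k y.1 :=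
    hU.is_const_of_deriv_eq_zero (convex_halfSpace_im_gt 0).isPreconnected hk hderiv hx hy
  exact (hfst hx x.2 0).trans (hconst.trans (hfst hy 0 y.2))

/-- A holomorphic map on `ℍ × ℂ` equivariant up to constants under such a set of translations is
affine. -/
theorem exists_affine_of_equivariant [CompleteSpace V] (hd : ContDiffOn ℂ ω h upperProd)
    (hinv : ∀ v ∈ Λ, ∃ c, ∀ x ∈ upperProd, h (x + toComplexProd v) = h x + c)
    {R : ℝ} (hR : ∀ v : ℝ × ℂ, ∃ u ∈ Λ, ‖v - u‖ ≤ R) (hdense : Dense (Prod.fst '' Λ)) :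
    ∃ (L : ℂ × ℂ →L[ℂ] V) (c : V), ∀ x ∈ upperProd, h x = L x + c := by
  have hdd : DifferentiableOn ℂ (fderiv ℂ h) upperProd :=
    (hd.fderiv_of_isOpen (m := 1) isOpen_upperProd (by simp)).differentiableOn (by simp)
  have hdiff : DifferentiableOn ℂ h upperProd := hd.differentiableOn (by simp)
  -- Differentiation removes the additive constant `c`.
  have hinv' : ∀ x ∈ upperProd, ∀ v ∈ Λ, fderiv ℂ h (x + toComplexProd v) = fderiv ℂ h x := by
    intro x hx v hv
    obtain ⟨c, hc⟩ := hinv v hv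
    rw [← fderiv_comp_add_right, ← fderiv_add_const (f := h) c]
    refine Filter.EventuallyEq.fderiv_eq ?_
    filter_upwards [isOpen_upperProd.mem_nhds hx] with y hy using hc y hy
  have hI : ((Complex.I, 0) : ℂ × ℂ) ∈ upperProd := by simp [upperProd]
  let L := fderiv ℂ h (Complex.I, 0)
  have hzero : ∀ x ∈ upperProd, fderiv ℂ (fun y => h y - L y) x = 0 := by
    intro x hx
    have hL := eq_of_invariant hdd hinv' hR hdense hx hI
    rw [fderiv_fun_sub (hdiff.differentiableAt (isOpen_upperProd.mem_nhds hx)) L.differentiableAt,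
      L.fderiv, hL, sub_self]
  refine ⟨L, h (Complex.I, 0) - L (Complex.I, 0), fun x hx => ?_⟩
  have := isOpen_upperProd.is_const_of_fderiv_eq_zero convex_upperProd.isPreconnected
    (hdiff.fun_sub L.differentiable.differentiableOn) hzero hx hI
  rw [← this]
  abel

end Invariant

/-! ### Lifting to the covering space -/

section Lifting

variable {E X : Type*} [TopologicalSpace E] [TopologicalSpace X] {π : E → X}

/-- A self-homeomorphism of the base of a simply connected covering lifts to the total space. -/
theorem IsCoveringMap.exists_homeomorph_lift [SimplyConnectedSpace E] [LocallyPathConnectedSpace E]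
    (hπ : IsCoveringMap π) (hsurj : Function.Surjective π) (f : X ≃ₜ X) :
    ∃ F : E ≃ₜ E, ∀ x, π (F x) = f (π x) := by
  obtain ⟨x₀⟩ : Nonempty E := inferInstance
  obtain ⟨y₀, hy₀⟩ := hsurj (f (π x₀))
  obtain ⟨F, ⟨hF₀, hF⟩, -⟩ := hπ.existsUnique_continuousMap_lifts
    ((f : C(X, X)).comp ⟨π, hπ.continuous⟩) x₀ y₀ hy₀
  obtain ⟨F', ⟨hF₀', hF'⟩, -⟩ := hπ.existsUnique_continuousMap_lifts
    ((f.symm : C(X, X)).comp ⟨π, hπ.continuous⟩) y₀ x₀ (by simp [hy₀])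
  have h1 : ∀ x, π (F x) = f (π x) := congrFun hF
  have h2 : ∀ x, π (F' x) = f.symm (π x) := congrFun hF'
  -- Both sides lift `π` and agree at `x₀`, so uniqueness of lifts applies.
  have h3 : F' ∘ F = id := hπ.eq_of_comp_eq (F'.continuous.comp F.continuous) continuous_id
    (by funext x; simp [h1, h2]) x₀ (by simp [hF₀, hF₀'])
  have h4 : F ∘ F' = id := hπ.eq_of_comp_eq (F.continuous.comp F'.continuous) continuous_id
    (by funext x; simp [h1, h2]) y₀ (by simp [hF₀, hF₀'])
  exact ⟨⟨⟨F, F', congrFun h3, congrFun h4⟩, F.continuous, F'.continuous⟩, h1⟩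

/-- A lift of a self-map of the base normalises the group of deck transformations. -/
theorem IsCoveringMap.conj_mem_of_lift [PreconnectedSpace E] [Nonempty E] (hπ : IsCoveringMap π)
    {Γ : Subgroup (Equiv.Perm E)} (hΓ : ∀ g ∈ Γ, Continuous g)
    (hfib : ∀ x y, π x = π y ↔ ∃ g ∈ Γ, g x = y) {f : X → X} {F : Equiv.Perm E}
    (hFc : Continuous F) (hF : ∀ x, π (F x) = f (π x)) {g : Equiv.Perm E} (hg : g ∈ Γ) :
    F * g * F⁻¹ ∈ Γ := by
  obtain ⟨x₀⟩ : Nonempty E := inferInstance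
  have hπg : ∀ g ∈ Γ, ∀ x, π (g x) = π x := fun g hg x => ((hfib _ _).2 ⟨g, hg, rfl⟩).symm
  -- `g'` is chosen at one point only; uniqueness of lifts propagates `g' ∘ F = F ∘ g` everywhere.
  obtain ⟨g', hg', h⟩ := (hfib (F x₀) (F (g x₀))).1 (by rw [hF, hF, hπg g hg])
  have : g' ∘ F = F ∘ g := hπ.eq_of_comp_eq ((hΓ g' hg').comp hFc) (hFc.comp (hΓ g hg))
    (by funext x; simp [hF, hπg g' hg', hπg g hg]) x₀ h
  have : F * g = g' * F := Equiv.ext fun x => (congrFun this x).symm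
  rwa [this, mul_inv_cancel_right]

/-- A local homeomorphism onto whose fibres are the orbits of a freely acting group of
homeomorphisms is a covering map. -/
theorem IsLocalHomeomorph.isCoveringMap_of_free (hπ : IsLocalHomeomorph π)
    (hsurj : Function.Surjective π) {Γ : Subgroup (Equiv.Perm E)} (hΓ : ∀ g ∈ Γ, Continuous g)
    (hfib : ∀ x y, π x = π y ↔ ∃ g ∈ Γ, g x = y) (hfree : ∀ g ∈ Γ, ∀ x, g x = x → g = 1) :
    IsCoveringMap π := by
  have hq : IsQuotientCoveringMap π Γ :=
    { toIsQuotientMap := hπ.isOpenMap.isQuotientMap hπ.continuous hsurj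
      continuous_const_smul := fun g => hΓ g g.2
      apply_eq_iff_mem_orbit := by
        intro x y
        rw [eq_comm, hfib]
        exact ⟨fun ⟨g, hg, h⟩ => ⟨⟨g, hg⟩, h⟩, fun ⟨g, h⟩ => ⟨g, g.2, h⟩⟩
      disjoint := by
        intro x
        obtain ⟨U, hU, hxU, hinj⟩ := hπ.isLocallyInjective x
        refine ⟨U, hU.mem_nhds hxU, ?_⟩
        rintro g ⟨_, ⟨y, hy, rfl⟩, hgy⟩
        exact Subtype.ext (hfree g g.2 y (hinj hgy hy ((hfib _ _).2 ⟨g, g.2, rfl⟩).symm)) }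
  exact hq.isCoveringMap

end Lifting

/-! ### Diagonal affine transformations and the group `G_M` -/

/-- The permutation `F` of `ℍ × ℂ` has the form `(w, z) ↦ (p w + v₁, s z + v₂)`. -/
def IsDiagAffine (F : Equiv.Perm (ℍ × ℂ)) (p : ℝ) (s : ℂ) (v : ℝ × ℂ) : Prop :=
  ∀ x, ((F x).1 : ℂ) = p * (x.1 : ℂ) + v.1 ∧ (F x).2 = s * x.2 + v.2

namespace IsDiagAffine

variable {F F' : Equiv.Perm (ℍ × ℂ)} {p p' : ℝ} {s s' : ℂ} {v v' : ℝ × ℂ}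

theorem ext (h : IsDiagAffine F p s v) (h' : IsDiagAffine F' p s v) : F = F' :=
  Equiv.ext fun x => Prod.ext (UpperHalfPlane.ext ((h x).1.trans (h' x).1.symm))
    ((h x).2.trans (h' x).2.symm)

theorem one : IsDiagAffine 1 1 1 0 := fun x => by simp

theorem mul (h : IsDiagAffine F p s v) (h' : IsDiagAffine F' p' s' v') :
    IsDiagAffine (F * F') (p * p') (s * s') (diagScale p s v' + v) := fun x => by
  simp only [Equiv.Perm.mul_apply, (h _).1, (h _).2, (h' x).1, (h' x).2, diagScale_apply,
    Prod.fst_add, Prod.snd_add]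
  constructor
  · push_cast
    ring
  · ring

theorem inv (h : IsDiagAffine F p s v) (hp : p ≠ 0) (hs : s ≠ 0) :
    IsDiagAffine F⁻¹ p⁻¹ s⁻¹ (-diagScale p⁻¹ s⁻¹ v) := fun x => by
  have h1 := h (F⁻¹ x)
  rw [show F (F⁻¹ x) = x from F.apply_symm_apply x] at h1
  have hp' : (p : ℂ) ≠ 0 := by exact_mod_cast hp
  simp only [h1.1, h1.2, diagScale_apply, Prod.fst_neg, Prod.snd_neg]
  constructor
  · push_cast
    field_simp
    ring
  · field_simp
    ring

theorem unique (h : IsDiagAffine F p s v) (h' : IsDiagAffine F p' s' v') :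
    p = p' ∧ s = s' ∧ v = v' := by
  have h1 : (p : ℂ) * Complex.I + v.1 = p' * Complex.I + v'.1 :=
    (h (UpperHalfPlane.I, 0)).1.symm.trans (h' (UpperHalfPlane.I, 0)).1
  have h2 : s * 0 + v.2 = s' * 0 + v'.2 :=
    (h (UpperHalfPlane.I, 0)).2.symm.trans (h' (UpperHalfPlane.I, 0)).2
  have h3 : s * 1 + v.2 = s' * 1 + v'.2 :=
    (h (UpperHalfPlane.I, 1)).2.symm.trans (h' (UpperHalfPlane.I, 1)).2
  have h4 : v.2 = v'.2 := by simpa using h2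
  refine ⟨by simpa using congrArg Complex.im h1, by simpa [h4] using h3,
    Prod.ext (by simpa using congrArg Complex.re h1) h4⟩

theorem continuous (h : IsDiagAffine F p s v) : Continuous F := by
  refine Continuous.prodMk (f := fun x => (F x).1) (g := fun x => (F x).2) ?_ ?_
  · rw [UpperHalfPlane.isOpenEmbedding_coe.isEmbedding.continuous_iff]
    have : (UpperHalfPlane.coe ∘ fun x => (F x).1) =
        fun x : ℍ × ℂ => (p : ℂ) * (x.1 : ℂ) + v.1 := funext fun x => (h x).1
    rw [this]
    exact (continuous_const.mul (UpperHalfPlane.continuous_coe.comp continuous_fst)).add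
      continuous_const
  · simp only [fun x => (h x).2]
    fun_prop

end IsDiagAffine

namespace InoueSMData

variable (D : InoueSMData)

theorem g₀_mem : D.g₀ ∈ D.G := Subgroup.subset_closure (Set.mem_insert _ _)

theorem g_mem (i : Fin 3) : D.g i ∈ D.G :=
  Subgroup.subset_closure (Set.mem_insert_of_mem _ ⟨i, rfl⟩)

theorem isDiagAffine_g₀ : IsDiagAffine D.g₀ D.α D.β 0 := fun x =>
  ⟨by simp [D.g₀_apply_fst], by simp [D.g₀_apply_snd]⟩

theorem isDiagAffine_g (i : Fin 3) : IsDiagAffine (D.g i) 1 1 (D.period i) := fun x =>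
  ⟨by simp [D.g_apply_fst, period], by simp [D.g_apply_snd, period]⟩

theorem isDiagAffine_g₀_zpow (n : ℤ) : IsDiagAffine (D.g₀ ^ n) (D.α ^ n) (D.β ^ n) 0 := by
  have h1 := D.α_pos.ne'
  have h2 := D.β_ne_zero
  induction n with
  | zero => simpa using IsDiagAffine.one
  | succ n ih =>
    rw [zpow_add_one, zpow_add_one₀ h1, zpow_add_one₀ h2]
    simpa [Prod.mk_zero_zero] using ih.mul D.isDiagAffine_g₀
  | pred n ih =>
    rw [zpow_sub_one, zpow_sub_one₀ h1, zpow_sub_one₀ h2]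
    simpa [Prod.mk_zero_zero] using ih.mul (D.isDiagAffine_g₀.inv h1 h2)

/-- Every element of `G_M` has the form `(w, z) ↦ (αⁿ w + v₁, βⁿ z + v₂)` with `v` in the
lattice. -/
theorem exists_isDiagAffine_of_mem {g : Equiv.Perm (ℍ × ℂ)} (hg : g ∈ D.G) :
    ∃ n : ℤ, ∃ v ∈ D.lattice, IsDiagAffine g (D.α ^ n) (D.β ^ n) v := by
  have h1 := D.α_pos.ne'
  have h2 := D.β_ne_zero
  induction hg using Subgroup.closure_induction with
  | mem g hg =>
    rcases hg with rfl | ⟨i, rfl⟩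
    · exact ⟨1, 0, zero_mem _, by simpa using D.isDiagAffine_g₀⟩
    · exact ⟨0, _, D.period_mem_lattice i, by simpa using D.isDiagAffine_g i⟩
  | one => exact ⟨0, 0, zero_mem _, by simpa using IsDiagAffine.one⟩
  | mul g g' _ _ ih ih' =>
    obtain ⟨n, v, hv, h⟩ := ih
    obtain ⟨n', v', hv', h'⟩ := ih'
    refine ⟨n + n', _, add_mem (D.diagScale_zpow_mem_lattice n hv') hv, ?_⟩
    rw [zpow_add₀ h1, zpow_add₀ h2]
    exact h.mul h'
  | inv g _ ih =>
    obtain ⟨n, v, hv, h⟩ := ih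
    refine ⟨-n, _, neg_mem (D.diagScale_zpow_mem_lattice (-n) hv), ?_⟩
    simpa using h.inv (zpow_ne_zero n h1) (zpow_ne_zero n h2)

/-- `G_M` contains all translations by lattice vectors. -/
theorem exists_translation_mem {v : ℝ × ℂ} (hv : v ∈ D.lattice) :
    ∃ t ∈ D.G, IsDiagAffine t 1 1 v := by
  let S : AddSubgroup (ℝ × ℂ) :=
    { carrier := {v | ∃ t ∈ D.G, IsDiagAffine t 1 1 v}
      zero_mem' := ⟨1, one_mem _, IsDiagAffine.one⟩
      add_mem' := by
        rintro v w ⟨t, ht, h⟩ ⟨u, hu, h'⟩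
        exact ⟨u * t, mul_mem hu ht, by simpa using h'.mul h⟩
      neg_mem' := by
        rintro v ⟨t, ht, h⟩
        exact ⟨t⁻¹, inv_mem ht, by simpa using h.inv one_ne_zero one_ne_zero⟩ }
  have : D.lattice ≤ S.toIntSubmodule :=
    Submodule.span_le.2 (by rintro _ ⟨i, rfl⟩; exact ⟨_, D.g_mem i, D.isDiagAffine_g i⟩)
  exact this hv

theorem continuous_of_mem {g : Equiv.Perm (ℍ × ℂ)} (hg : g ∈ D.G) : Continuous g := by
  obtain ⟨n, v, -, h⟩ := D.exists_isDiagAffine_of_mem hg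
  exact h.continuous

/-- At a fixed point, comparing imaginary parts in `ℍ` gives `αⁿ = 1`, so `n = 0`; a translation
with a fixed point is trivial. -/
theorem eq_one_of_apply_eq {g : Equiv.Perm (ℍ × ℂ)} (hg : g ∈ D.G) {x : ℍ × ℂ} (hx : g x = x) :
    g = 1 := by
  obtain ⟨n, v, -, h⟩ := D.exists_isDiagAffine_of_mem hg
  have h1 := h x
  rw [hx] at h1
  have hα : D.α ^ n = 1 := by
    have := congrArg Complex.im h1.1
    rw [Complex.add_im, Complex.im_ofReal_mul, Complex.ofReal_im, add_zero] at this
    exact mul_right_cancel₀ x.1.im_ne_zero (by simpa using this.symm)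
  have hn : n = 0 := by
    by_contra hn
    exact hn (zpow_right_injective₀ D.α_pos D.one_lt_α.ne' (by simpa using hα))
  subst hn
  have hv : v = 0 := by
    ext1
    · simpa using h1.1
    · simpa using h1.2
  subst hv
  exact h.ext (by simpa using IsDiagAffine.one)

end InoueSMData

theorem norm_diagScale_le (p : ℝ) (s : ℂ) (v : ℝ × ℂ) :
    ‖diagScale p s v‖ ≤ ‖(p, s)‖ * ‖v‖ :=
  norm_mul_le (p, s) v

namespace IsDiagAffine

variable {F F' : Equiv.Perm (ℍ × ℂ)} {p p' : ℝ} {s s' : ℂ} {v v' : ℝ × ℂ}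

theorem conjugate (h : IsDiagAffine F p s v) (h' : IsDiagAffine F' p' s' v') :
    IsDiagAffine (F * F' * F⁻¹) p' s' (diagScale p s v' + v - diagScale p' s' v) := fun x => by
  obtain ⟨y, rfl⟩ := F.surjective x
  have h1 : (F * F' * F⁻¹) (F y) = (F * F') y :=
    congrArg (F * F') (F.symm_apply_apply y)
  rw [h1, (h.mul h' y).1, (h.mul h' y).2, (h y).1, (h y).2]
  simp only [diagScale_apply, Prod.fst_add, Prod.snd_add, Prod.fst_sub, Prod.snd_sub]
  constructor
  · push_cast
    ring
  · ring

/-- The multipliers commute and cancel, so only a translation remains. -/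
theorem commutator (h : IsDiagAffine F p s v) (h' : IsDiagAffine F' p' s' v')
    (hp' : p' ≠ 0) (hs' : s' ≠ 0) :
    IsDiagAffine (F * F' * F⁻¹ * F'⁻¹) 1 1
      (diagScale p s v' + v - (diagScale p' s' v + v')) := by
  have := (h.conjugate h').mul (h'.inv hp' hs')
  rw [mul_inv_cancel₀ hp', mul_inv_cancel₀ hs'] at this
  convert this using 1
  ext1
  · simp [hp']
    ring
  · simp [hs']
    ring

end IsDiagAffine

/-! ### Normalising transformations are diagonal affine -/

/-- The expression in coordinates of a self-map of `ℍ × ℂ`. -/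
noncomputable def coordMap (F : ℍ × ℂ → ℍ × ℂ) (x : ℂ × ℂ) : ℂ × ℂ :=
  ((F (UpperHalfPlane.ofComplex x.1, x.2)).1, (F (UpperHalfPlane.ofComplex x.1, x.2)).2)

theorem coordMap_coe (F : ℍ × ℂ → ℍ × ℂ) (x : ℍ × ℂ) :
    coordMap F (x.1, x.2) = (((F x).1 : ℂ), (F x).2) := by
  simp [coordMap]

theorem contDiffOn_coordMap {F : ℍ × ℂ → ℍ × ℂ}
    (hF : ContMDiff (𝓘(ℂ).prod 𝓘(ℂ)) (𝓘(ℂ).prod 𝓘(ℂ)) ω F) :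
    ContDiffOn ℂ ω (coordMap F) upperProd := by
  intro x hx
  have h1 : ContMDiffAt 𝓘(ℂ, ℂ × ℂ) (𝓘(ℂ).prod 𝓘(ℂ)) ω
      (fun y : ℂ × ℂ => (UpperHalfPlane.ofComplex y.1, y.2)) x :=
    ((UpperHalfPlane.contMDiffAt_ofComplex hx).comp x
      contDiff_fst.contMDiff.contMDiffAt).prodMk contDiff_snd.contMDiff.contMDiffAt
  have h2 := (hF _).comp x h1
  refine ContDiffAt.contDiffWithinAt (ContDiffAt.prodMk ?_ ?_)
  · exact contMDiffAt_iff_contDiffAt.1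
      ((UpperHalfPlane.contMDiff_coe _).comp x (contMDiffAt_fst.comp x h2))
  · exact contMDiffAt_iff_contDiffAt.1 (contMDiffAt_snd.comp x h2)

section SmoothLift

variable {𝕜 : Type*} [NontriviallyNormedField 𝕜]
  {E E' : Type*} [NormedAddCommGroup E] [NormedSpace 𝕜 E] [NormedAddCommGroup E'] [NormedSpace 𝕜 E']
  {H H' : Type*} [TopologicalSpace H] [TopologicalSpace H']
  {I : ModelWithCorners 𝕜 E H} {J : ModelWithCorners 𝕜 E' H'}
  {N X : Type*} [TopologicalSpace N] [ChartedSpace H N] [TopologicalSpace X] [ChartedSpace H' X]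
  {n : ℕ∞ω}

/-- A continuous lift of a `C^n` map through a local diffeomorphism is `C^n`. -/
theorem IsLocalDiffeomorph.contMDiff_of_lift {π : N → X} (hπ : IsLocalDiffeomorph I J n π)
    {f : X → X} (hf : ContMDiff J J n f) {F : N → N} (hFc : Continuous F)
    (hF : ∀ x, π (F x) = f (π x)) : ContMDiff I I n F := by
  intro x
  have h := hπ (F x)
  have h1 : ContMDiffAt J I n h.localInverse (f (π x)) := hF x ▸ h.localInverse_contMDiffAt
  have h2 : ContMDiffAt I I n (h.localInverse ∘ (f ∘ π)) x :=
    h1.comp x ((hf _).comp x (hπ.contMDiff x))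
  refine h2.congr_of_eventuallyEq ?_
  filter_upwards [hFc.continuousAt.eventually h.localInverse_eventuallyEq_left] with y hy
  simpa [hF] using hy.symm

end SmoothLift

namespace InoueSMData

variable (D : InoueSMData)

/-- The periods `((α - 1) c, (β - 1) d)`, for `(c, d)` in the lattice, of the commutators of
`G_M`. -/
def commutatorLattice : Set (ℝ × ℂ) := diagScale (D.α - 1) (D.β - 1) '' D.lattice

theorem exists_mem_commutatorLattice_norm_sub_le :
    ∃ R : ℝ, ∀ v : ℝ × ℂ, ∃ u ∈ D.commutatorLattice, ‖v - u‖ ≤ R := by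
  have hα : D.α - 1 ≠ 0 := sub_ne_zero.2 D.one_lt_α.ne'
  have hβ : D.β - 1 ≠ 0 := sub_ne_zero.2 D.β_ne_one
  refine ⟨‖(D.α - 1, D.β - 1)‖ * ∑ i, ‖D.period i‖, fun v => ?_⟩
  obtain ⟨u, hu, hle⟩ :=
    D.exists_mem_lattice_norm_sub_le (diagScale (D.α - 1)⁻¹ (D.β - 1)⁻¹ v)
  refine ⟨_, ⟨u, hu, rfl⟩, ?_⟩
  have : v - diagScale (D.α - 1) (D.β - 1) u = diagScale (D.α - 1) (D.β - 1)
      (diagScale (D.α - 1)⁻¹ (D.β - 1)⁻¹ v - u) := by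
    rw [map_sub]
    congr 1
    ext1 <;> simp [hα, hβ]
  rw [this]
  exact (norm_diagScale_le _ _ _).trans (mul_le_mul_of_nonneg_left hle (norm_nonneg _))

theorem dense_fst_commutatorLattice : Dense (Prod.fst '' D.commutatorLattice) := by
  have hα : D.α - 1 ≠ 0 := sub_ne_zero.2 D.one_lt_α.ne'
  have h := (mul_left_surjective₀ hα).denseRange.dense_image (continuous_const_mul _)
    D.dense_fst_lattice
  rw [Set.image_image] at h
  rw [commutatorLattice, Set.image_image]
  exact h

/-- Translation by `v` is the commutator of `g₀` with a lattice translation. Its conjugate by `F` is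
a commutator of elements of `G_M`, hence again a translation. -/
theorem equivariant_coordMap {F : Equiv.Perm (ℍ × ℂ)} (hconj : ∀ g ∈ D.G, F * g * F⁻¹ ∈ D.G)
    {v : ℝ × ℂ} (hv : v ∈ D.commutatorLattice) :
    ∃ c, ∀ x ∈ upperProd, coordMap F (x + toComplexProd v) = coordMap F x + c := by
  obtain ⟨u, hu, rfl⟩ := hv
  obtain ⟨t, ht, hut⟩ := D.exists_translation_mem hu
  have hc := D.isDiagAffine_g₀.commutator hut one_ne_zero one_ne_zero
  obtain ⟨n, u₁, -, h₁⟩ := D.exists_isDiagAffine_of_mem (hconj _ D.g₀_mem)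
  obtain ⟨m, u₂, -, h₂⟩ := D.exists_isDiagAffine_of_mem (hconj _ ht)
  have hc' := h₁.commutator h₂ (zpow_ne_zero m D.α_pos.ne') (zpow_ne_zero m D.β_ne_zero)
  set e := D.g₀ * t * D.g₀⁻¹ * t⁻¹
  have he : F * D.g₀ * F⁻¹ * (F * t * F⁻¹) * (F * D.g₀ * F⁻¹)⁻¹ * (F * t * F⁻¹)⁻¹ =
      F * e * F⁻¹ := by
    simp only [e]
    group
  rw [he] at hc'
  generalize diagScale (D.α ^ n) (D.β ^ n) u₂ + u₁ -
    (diagScale (D.α ^ m) (D.β ^ m) u₁ + u₂) = c at hc'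
  refine ⟨toComplexProd c, fun x hx => ?_⟩
  let y : ℍ × ℂ := (⟨x.1, hx⟩, x.2)
  have hey : x + toComplexProd (diagScale (D.α - 1) (D.β - 1) u) =
      (((e y).1 : ℂ), (e y).2) := by
    rw [(hc y).1, (hc y).2]
    ext1
    · simp [toComplexProd, y]
      ring
    · simp [toComplexProd, y]
      ring
  have hFe : (F * e * F⁻¹) (F y) = F (e y) :=
    congrArg (fun z => F (e z)) (F.symm_apply_apply y)
  have hy := hc' (F y)
  rw [hFe] at hy
  rw [hey, coordMap_coe, hy.1, hy.2, show x = ((y.1 : ℂ), y.2) from rfl, coordMap_coe]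
  simp [toComplexProd]

/-- A holomorphic transformation of `ℍ × ℂ` normalising `G_M` is diagonal affine. -/
theorem exists_isDiagAffine_of_normalizes {F : Equiv.Perm (ℍ × ℂ)}
    (hF : ContMDiff (𝓘(ℂ).prod 𝓘(ℂ)) (𝓘(ℂ).prod 𝓘(ℂ)) ω F)
    (hconj : ∀ g ∈ D.G, F * g * F⁻¹ ∈ D.G) :
    ∃ (p : ℝ) (s : ℂ) (v : ℝ × ℂ), 0 < p ∧ s ≠ 0 ∧ IsDiagAffine F p s v := by
  obtain ⟨R, hR⟩ := D.exists_mem_commutatorLattice_norm_sub_le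
  obtain ⟨L, c, hL⟩ := exists_affine_of_equivariant (contDiffOn_coordMap hF)
    (fun v hv => D.equivariant_coordMap hconj hv) hR D.dense_fst_commutatorLattice
  obtain ⟨A, B, C, E, hform⟩ : ∃ A B C E : ℂ, ∀ x : ℍ × ℂ,
      ((F x).1 : ℂ) = A * x.1 + B * x.2 + c.1 ∧ (F x).2 = C * x.1 + E * x.2 + c.2 := by
    refine ⟨(L (1, 0)).1, (L (0, 1)).1, (L (1, 0)).2, (L (0, 1)).2, fun x => ?_⟩
    have h1 := hL (x.1, x.2) x.1.im_pos
    have h2 : L ((x.1 : ℂ), x.2) = (x.1 : ℂ) • L (1, 0) + x.2 • L (0, 1) := by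
      rw [← map_smul, ← map_smul, ← map_add]
      simp
    rw [coordMap_coe, h2] at h1
    have h3 := congrArg Prod.fst h1
    have h4 := congrArg Prod.snd h1
    simp only [Prod.fst_add, Prod.snd_add, Prod.smul_fst, Prod.smul_snd, smul_eq_mul] at h3 h4
    exact ⟨by rw [h3]; ring, by rw [h4]; ring⟩
  -- Otherwise, varying `z` would let the first coordinate take the value `-i`, outside `ℍ`.
  have hB : B = 0 := by
    by_contra hB
    have h1 := (hform (UpperHalfPlane.I, (-Complex.I - c.1 - A * Complex.I) / B)).1
    have h2 : ((F (UpperHalfPlane.I, (-Complex.I - c.1 - A * Complex.I) / B)).1 : ℂ) =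
        -Complex.I := by
      rw [h1]
      simp only [UpperHalfPlane.coe_I]
      field_simp
      ring
    have h3 := (F (UpperHalfPlane.I, (-Complex.I - c.1 - A * Complex.I) / B)).1.im_pos
    rw [← UpperHalfPlane.coe_im, h2] at h3
    norm_num at h3
  subst hB
  simp only [zero_mul, add_zero] at hform
  have hA : A ≠ 0 := by
    rintro rfl
    simp only [zero_mul, zero_add] at hform
    have hconst : ∀ y : ℍ × ℂ, (y.1 : ℂ) = c.1 := fun y => by
      obtain ⟨x, rfl⟩ := F.surjective y
      exact (hform x).1
    have h1 := (hconst (UpperHalfPlane.I, 0)).trans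
      (hconst ((1 : ℝ) +ᵥ UpperHalfPlane.I, 0)).symm
    simp at h1
  have hE : E ≠ 0 := by
    rintro rfl
    have h1 : F (UpperHalfPlane.I, 0) = F (UpperHalfPlane.I, 1) :=
      Prod.ext (UpperHalfPlane.ext (by rw [(hform _).1, (hform _).1]))
        (by rw [(hform _).2, (hform _).2]; simp)
    simpa using F.injective h1
  have hconj' : ∀ g ∈ D.G, ∃ (n : ℤ) (u : ℝ × ℂ), ∀ x,
      ((F (g x)).1 : ℂ) = (D.α ^ n : ℝ) * (F x).1 + u.1 ∧
      (F (g x)).2 = D.β ^ n * (F x).2 + u.2 := by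
    intro g hg
    obtain ⟨n, u, -, h⟩ := D.exists_isDiagAffine_of_mem (hconj g hg)
    refine ⟨n, u, fun x => ?_⟩
    have h1 := h (F x)
    rwa [show (F * g * F⁻¹) (F x) = F (g x) from
      congrArg (fun z => F (g z)) (F.symm_apply_apply x)] at h1
  simp only [fun x => (hform x).1, fun x => (hform x).2] at hconj'
  have hI : Complex.I ≠ 0 := Complex.I_ne_zero
  -- Comparing values at `i` and `2i` separates the linear coefficients in `w` from the constants.
  let J : ℍ := ⟨2 * Complex.I, by simp⟩
  have hJ : (J : ℂ) = 2 * Complex.I := rfl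
  -- `F gᵢ F⁻¹` has multiplier `1`, and its real translation part `u₁` equals `A aᵢ`.
  obtain ⟨p, hp⟩ : ∃ p : ℝ, A = p := by
    obtain ⟨i, hi⟩ := Function.ne_iff.1 D.a_ne_zero
    have hi' : (D.a i : ℂ) ≠ 0 := by exact_mod_cast hi
    obtain ⟨n, u, h⟩ := hconj' _ (D.g_mem i)
    have h1 := (h (UpperHalfPlane.I, 0)).1
    have h2 := (h (J, 0)).1
    rw [D.g_apply_fst] at h1 h2
    simp only [UpperHalfPlane.coe_I, hJ] at h1 h2
    have h3 : ((D.α ^ n : ℝ) : ℂ) = 1 := by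
      have : A * Complex.I * (((D.α ^ n : ℝ) : ℂ) - 1) = 0 := by linear_combination h1 - h2
      simpa [hA, sub_eq_zero] using this
    rw [h3] at h1
    refine ⟨u.1 / D.a i, ?_⟩
    push_cast
    rw [eq_div_iff hi']
    linear_combination h1
  obtain ⟨n, u, h⟩ := hconj' _ D.g₀_mem
  have h1 := (h (UpperHalfPlane.I, 0)).1
  have h2 := (h (J, 0)).1
  have h4 := (h (UpperHalfPlane.I, 0)).2
  have h5 := (h (J, 0)).2
  rw [D.g₀_apply_fst] at h1 h2 h4 h5
  rw [D.g₀_apply_snd] at h4 h5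
  simp only [UpperHalfPlane.coe_I, hJ] at h1 h2 h4 h5
  have hαn : ((D.α ^ n : ℝ) : ℂ) = D.α := by
    have : A * Complex.I * (((D.α ^ n : ℝ) : ℂ) - D.α) = 0 := by linear_combination h1 - h2
    simpa [hA, sub_eq_zero] using this
  have hn : n = 1 :=
    zpow_right_injective₀ D.α_pos D.one_lt_α.ne' (by simpa using Complex.ofReal_injective hαn)
  subst hn
  rw [hαn] at h1
  rw [zpow_one] at h4 h5
  -- The conjugate of `g₀` has multipliers `α`, `β`; a mixed term `C w` would need `α = β`.
  have hC : C = 0 := by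
    have : C * Complex.I * (D.α - D.β) = 0 := by linear_combination h5 - h4
    simpa [sub_eq_zero, D.α_ne_β] using this
  subst hC hp
  -- `(α - 1) c₁` is minus the real translation part of the conjugate of `g₀`.
  have hc1 : c.1.im = 0 := by
    have h6 : (D.α - 1 : ℝ) * c.1 = -u.1 := by
      push_cast
      linear_combination -h1
    have h7 := congrArg Complex.im h6
    rw [Complex.im_ofReal_mul] at h7
    simpa [sub_eq_zero, D.one_lt_α.ne'] using h7
  have hp : 0 < p := by
    have h6 := (F (UpperHalfPlane.I, 0)).1.im_pos
    rw [← UpperHalfPlane.coe_im, (hform _).1] at h6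
    simpa [hc1] using h6
  refine ⟨p, E, (c.1.re, c.2), hp, hE, fun x => ⟨?_, ?_⟩⟩
  · rw [(hform x).1]
    congr 1
    exact Complex.ext (by simp) (by simp [hc1])
  · rw [(hform x).2]
    simp

end InoueSMData

/-! ### Finiteness modulo `G_M` -/

namespace InoueSMData

variable (D : InoueSMData)

section Form

variable {D} {F : Equiv.Perm (ℍ × ℂ)} {p : ℝ} {s : ℂ} {v : ℝ × ℂ}

theorem diagScale_period_mem_lattice_of_conj_mem (h : IsDiagAffine F p s v)
    (hconj : ∀ g ∈ D.G, F * g * F⁻¹ ∈ D.G) (i : Fin 3) :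
    diagScale p s (D.period i) ∈ D.lattice := by
  obtain ⟨n, u, hu, h'⟩ := D.exists_isDiagAffine_of_mem (hconj _ (D.g_mem i))
  obtain ⟨-, -, rfl⟩ := (h.conjugate (D.isDiagAffine_g i)).unique h'
  have : diagScale 1 1 v = v := by ext1 <;> simp
  rwa [this, add_sub_cancel_right] at hu

theorem sub_diagScale_mem_lattice_of_conj_mem (h : IsDiagAffine F p s v)
    (hconj : ∀ g ∈ D.G, F * g * F⁻¹ ∈ D.G) : v - diagScale D.α D.β v ∈ D.lattice := by
  obtain ⟨n, u, hu, h'⟩ := D.exists_isDiagAffine_of_mem (hconj _ D.g₀_mem)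
  obtain ⟨-, -, rfl⟩ := (h.conjugate D.isDiagAffine_g₀).unique h'
  rwa [map_zero, zero_add] at hu

/-- `F⁻¹` also preserves the lattice, so its determinant is at least one. -/
theorem normSq_le_of_conj_mem (h : IsDiagAffine F p s v) (hp : 0 < p) (hs : s ≠ 0)
    (hconj : ∀ g ∈ D.G, F⁻¹ * g * F ∈ D.G) : p * Complex.normSq s ≤ 1 := by
  have h1 := D.one_le_mul_normSq (inv_pos.2 hp) (inv_ne_zero hs)
    (diagScale_period_mem_lattice_of_conj_mem (h.inv hp.ne' hs) (by simpa using hconj))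
  rw [map_inv₀, ← mul_inv] at h1
  exact (one_le_inv₀ (mul_pos hp (Complex.normSq_pos.2 hs))).1 h1

variable (D) in
/-- A diagonal affine transformation can be moved into a bounded set by an element of `G_M`. -/
theorem exists_mul_isDiagAffine (h : IsDiagAffine F p s v) (hp : 0 < p) (hs : s ≠ 0) :
    ∃ g ∈ D.G, ∃ (p' : ℝ) (s' : ℂ) (v' : ℝ × ℂ), IsDiagAffine (g * F) p' s' v' ∧
      1 ≤ p' ∧ p' ≤ D.α ∧ s' ≠ 0 ∧ ‖v'‖ ≤ ∑ i, ‖D.period i‖ := by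
  -- `αⁿ ≤ p < αⁿ⁺¹`: a power of `g₀` normalises `p`, then a lattice translation bounds `v`.
  obtain ⟨n, hn1, hn2⟩ := exists_mem_Ico_zpow hp D.one_lt_α
  have hF' := (D.isDiagAffine_g₀_zpow (-n)).mul h
  rw [add_zero] at hF'
  obtain ⟨u, hu, hle⟩ :=
    D.exists_mem_lattice_norm_sub_le (diagScale (D.α ^ (-n)) (D.β ^ (-n)) v)
  obtain ⟨t, ht, hut⟩ := D.exists_translation_mem (neg_mem hu)
  have hpos := zpow_pos D.α_pos n
  refine ⟨t * D.g₀ ^ (-n), mul_mem ht (zpow_mem D.g₀_mem _), D.α ^ (-n) * p,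
    D.β ^ (-n) * s, _, ?_, ?_, ?_, ?_, hle⟩
  · have := hut.mul hF'
    rw [← mul_assoc, one_mul, one_mul] at this
    convert this using 1
    ext1 <;> simp <;> ring
  · rw [zpow_neg, inv_mul_eq_div, one_le_div hpos]
    exact hn1
  · rw [zpow_neg, inv_mul_eq_div, div_le_iff₀ hpos, mul_comm, ← zpow_add_one₀ D.α_pos.ne']
    exact hn2.le
  · exact mul_ne_zero (zpow_ne_zero _ D.β_ne_zero) hs

end Form

/-- The set of normalised diagonal affine transformations of `ℍ × ℂ` normalising `G_M`. -/
def reducedNormalizer : Set (Equiv.Perm (ℍ × ℂ)) :=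
  {F | ∃ (p : ℝ) (s : ℂ) (v : ℝ × ℂ), IsDiagAffine F p s v ∧
    1 ≤ p ∧ p ≤ D.α ∧ s ≠ 0 ∧ ‖v‖ ≤ ∑ i, ‖D.period i‖ ∧
    (∀ g ∈ D.G, F * g * F⁻¹ ∈ D.G) ∧ ∀ g ∈ D.G, F⁻¹ * g * F ∈ D.G}

theorem finite_reducedNormalizer : D.reducedNormalizer.Finite := by
  set R := ∑ i, ‖D.period i‖
  have hR : ∀ i, ‖D.period i‖ ≤ R := fun i =>
    Finset.single_le_sum (f := fun i => ‖D.period i‖) (fun _ _ => norm_nonneg _)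
      (Finset.mem_univ i)
  have hR0 : 0 ≤ R := (norm_nonneg _).trans (hR 0)
  have hfin := fun r => D.finite_lattice_inter_closedBall r
  choose! p s v hF using fun F (hF : F ∈ D.reducedNormalizer) => hF
  -- All four entries lie in the lattice: the images of the periods, and the translation part of `F
  -- g₀ F⁻¹`.
  let code : Equiv.Perm (ℍ × ℂ) → (Fin 3 → ℝ × ℂ) × (ℝ × ℂ) := fun F =>
    (fun i => diagScale (p F) (s F) (D.period i), v F - diagScale D.α D.β (v F))
  refine Set.Finite.of_finite_image (f := code) (((Set.Finite.pi fun _ => hfin (D.α * R)).prod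
    (hfin (R + ‖(D.α, D.β)‖ * R))).subset ?_) ?_
  · rintro _ ⟨F, hFm, rfl⟩
    obtain ⟨h, h1, hα, hs, hv, hconj, hconj'⟩ := hF F hFm
    have hp : 0 < p F := one_pos.trans_le h1
    refine ⟨fun i _ => ⟨?_, diagScale_period_mem_lattice_of_conj_mem h hconj i⟩,
      ?_, sub_diagScale_mem_lattice_of_conj_mem h hconj⟩
    · rw [mem_closedBall_zero_iff]
      refine (norm_diagScale_le _ _ _).trans
        (mul_le_mul ?_ (hR i) (norm_nonneg _) D.α_pos.le)
      refine max_le (by simpa [abs_of_pos hp] using hα) ?_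
      have h2 := normSq_le_of_conj_mem h hp hs hconj'
      have h3 : Complex.normSq (s F) ≤ 1 :=
        (le_mul_of_one_le_left (Complex.normSq_nonneg _) h1).trans h2
      rw [Complex.normSq_eq_norm_sq, sq_le_one_iff₀ (norm_nonneg _)] at h3
      exact h3.trans D.one_lt_α.le
    · rw [mem_closedBall_zero_iff]
      exact (norm_sub_le _ _).trans (add_le_add hv ((norm_diagScale_le _ _ _).trans
        (mul_le_mul_of_nonneg_left hv (norm_nonneg _))))
  · intro F hFm F' hFm' hcode
    have h := (hF F hFm).1
    have h' := (hF F' hFm').1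
    -- Nonzero `aᵢ` and `bⱼ` recover `p` and `s`; `α ≠ 1` and `β ≠ 1` recover `v`.
    obtain ⟨i, hi⟩ := Function.ne_iff.1 D.a_ne_zero
    obtain ⟨j, hj⟩ := Function.ne_iff.1 D.b_ne_zero
    have h1 : ∀ i, diagScale (p F) (s F) (D.period i) = diagScale (p F') (s F') (D.period i) :=
      congrFun (congrArg Prod.fst hcode)
    have h2 : v F - diagScale D.α D.β (v F) = v F' - diagScale D.α D.β (v F') :=
      congrArg Prod.snd hcode
    have hp : p F = p F' := mul_right_cancel₀ hi (congrArg Prod.fst (h1 i))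
    have hs : s F = s F' := mul_right_cancel₀ hj (congrArg Prod.snd (h1 j))
    have hv : v F = v F' := by
      have h3 : (v F).1 - D.α * (v F).1 = (v F').1 - D.α * (v F').1 := congrArg Prod.fst h2
      have h4 : (v F).2 - D.β * (v F).2 = (v F').2 - D.β * (v F').2 := congrArg Prod.snd h2
      refine Prod.ext (mul_left_cancel₀ (sub_ne_zero.2 D.one_lt_α.ne) ?_)
        (mul_left_cancel₀ (sub_ne_zero.2 D.β_ne_one.symm) ?_)
      · linear_combination h3
      · linear_combination h4
    rw [← hp, ← hs, ← hv] at h'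
    exact h.ext h'

end InoueSMData

/-! ### Finiteness of the automorphism group -/

/-- The automorphism group of an Inoue surface of type `S_M` is finite. -/
theorem IsInoueSurfaceSM.finite_holomorphicAut {X : Type*} [TopologicalSpace X]
    [ChartedSpace (ℂ × ℂ) X] (hX : IsInoueSurfaceSM X) :
    Finite (holomorphicAut (ℂ × ℂ) X) := by
  obtain ⟨D, π, hπ, hsurj, hfib⟩ := hX
  have hcont : ∀ g ∈ D.G, Continuous g := fun g hg => D.continuous_of_mem hg
  have hcov : IsCoveringMap π := hπ.isLocalHomeomorph.isCoveringMap_of_free hsurj hcont hfib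
    fun g hg x hx => D.eq_one_of_apply_eq hg hx
  have hlift : ∀ f : holomorphicAut (ℂ × ℂ) X,
      ∃ F ∈ D.reducedNormalizer, ∀ x, π (F x) = f.1 (π x) := by
    intro f
    let φ : X ≃ₜ X := ⟨f.1, f.2.1.continuous, f.2.2.continuous⟩
    obtain ⟨Φ, hΦ⟩ := hcov.exists_homeomorph_lift hsurj φ
    let F : Equiv.Perm (ℍ × ℂ) := Φ.toEquiv
    have hΦ' : ∀ x, π (F⁻¹ x) = φ.symm (π x) := fun x => by
      rw [Homeomorph.eq_symm_apply, ← hΦ]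
      exact congrArg π (Φ.apply_symm_apply x)
    have hconj : ∀ g ∈ D.G, F * g * F⁻¹ ∈ D.G := fun g hg =>
      hcov.conj_mem_of_lift hcont hfib Φ.continuous hΦ hg
    have hconj' : ∀ g ∈ D.G, F⁻¹ * g * F ∈ D.G := fun g hg => by
      simpa using hcov.conj_mem_of_lift hcont hfib (F := F⁻¹) Φ.symm.continuous hΦ' hg
    obtain ⟨p, s, v, hp, hs, h⟩ := D.exists_isDiagAffine_of_normalizes
      (hπ.contMDiff_of_lift f.2.1 Φ.continuous hΦ : ContMDiff _ _ ω F) hconj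
    obtain ⟨g, hg, p', s', v', h', h1, hα, hs', hv'⟩ := D.exists_mul_isDiagAffine h hp hs
    refine ⟨g * F, ⟨p', s', v', h', h1, hα, hs', hv', fun k hk => ?_, fun k hk => ?_⟩, fun x => ?_⟩
    · have := mul_mem (mul_mem hg (hconj k hk)) (inv_mem hg)
      convert this using 1
      group
    · have := hconj' _ (mul_mem (mul_mem (inv_mem hg) hk) hg)
      convert this using 1
      group
    · exact ((hfib _ _).2 ⟨g, hg, rfl⟩).symm.trans (hΦ x)
  choose F hF hFπ using hlift
  have := D.finite_reducedNormalizer.to_subtype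
  -- A lift determines its automorphism because `π` is onto.
  refine Finite.of_injective (fun f => (⟨F f, hF f⟩ : D.reducedNormalizer)) fun f f' hff' => ?_
  have h1 : F f = F f' := congrArg Subtype.val hff'
  refine Subtype.ext (Equiv.ext fun y => ?_)
  obtain ⟨x, rfl⟩ := hsurj y
  rw [← hFπ, ← hFπ, h1]

/-- The trivial subgroup serves as `H₁`, with index `|H| ≤ |G|`. -/
theorem IsTJordan.of_finite (G : Type*) [Group G] [Finite G] : IsTJordan G := by
  refine ⟨Nat.card G, fun H _ => ⟨⊥, ?_, inferInstance, ?_⟩⟩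
  · rintro x hx y hy
    rw [Subgroup.mem_bot.1 hx, Subgroup.mem_bot.1 hy]
  · rw [Subgroup.index_bot]
    exact H.card_le_card_group

theorem theorem6p2 {X : Type*} [TopologicalSpace X] [ChartedSpace (ℂ × ℂ) X]
    [IsManifold 𝓘(ℂ, ℂ × ℂ) ω X] (hX : IsInoueSurfaceSM X) :
    (∀ G : Subgroup (holomorphicAut (ℂ × ℂ) X), (∀ g ∈ G, IsOfFinOrder g) → Finite G) ∧
      IsTJordan (holomorphicAut (ℂ × ℂ) X) := by
  have := hX.finite_holomorphicAut
  exact ⟨fun G _ => inferInstance, IsTJordan.of_finite _⟩
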